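/- Let $d,N\ge 1$ be integers. Let $\mathscr{B}_1\supseteq\mathscr{B}_2\supseteq\cdots\supseteq\mathscr{B}_m$ be nested Lebesgue measurable subsets of $\mathbb{R}^d$ with Lebesgue measures $\mathrm{vol}(\mathscr{B}_1)=V_{\max}$ and $\mathrm{vol}(\mathscr{B}_m)=V_{\min}$, where $0<V_{\min}<V_{\max}<\infty$. Let $X_{\ell,i}$ ($1\le \ell\le m$, $1\le i\le N$) be mutually independent random vectors with $X_{\ell,i}$ uniformly distributed over $\mathscr{B}_\ell$. Sample reuse is the following procedure. Put $Y_{1,i}=X_{1,i}$ for $1\le i\le N$. For $\ell=2,\dots,m$ let $i_1<\dots<i_{\mathbf{k}_\ell}$ be the indices $i\in\{1,\dots,N\}$ with $Y_{\ell-1,i}\in\mathscr{B}_\ell$ (so $\mathbf{k}_\ell$ is their number), and put $Y_{\ell,j}=Y_{\ell-1,i_j}$ for $1\le j\le \mathbf{k}_\ell$ and $Y_{\ell,j}=X_{\ell,j}$ for $\mathbf{k}_\ell<j\le N$. Let $\mathbf{n}_\ell=N-\mathbf{k}_\ell$, the number of new simulations for $\mathscr{B}_\ell$. Let $\boldsymbol{P}$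 be a Poisson random variable with mean $\lambda=N\ln\left(\frac{V_{\max}}{V_{\min}}\right)$. Then \[ \Pr\Big\{\sum_{\ell=2}^m\mathbf{n}_\ell=0\Big\}=\Pr\{\boldsymbol{P}=0\},\qquad \Pr\Big\{\sum_{\ell=2}^m\mathbf{n}_\ell\le k\Big\}>\Pr\{\boldsymbol{P}\le k\}\quad\text{for every integer }k\ge 1 . \] Moreover, for fixed $d$, $N$, $V_{\max}$ and $V_{\min}$, as the maximum volume difference $\max_{1\le\ell\le m-1}\left(\mathrm{vol}(\mathscr{B}_\ell)-\mathrm{vol}(\mathscr{B}_{\ell+1})\right)$ tends to $0$ (the number $m$ of sets, the sets and the samples being otherwise arbitrary), $\sum_{\ell=2}^m\mathbf{n}_\ell$ converges to $\boldsymbol{P}$ in distribution. -/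

import Mathlib

open MeasureTheory ProbabilityTheory Filter Topology

noncomputable section

namespace SampleReuse

/-- The indices `i` of the samples `x i` that fall into the set `A`. -/
def hitIndices {E : Type*} (A : Set E) {p : ℕ} (x : Fin p → E) : Finset (Fin p) :=
  open Classical in Finset.univ.filter fun i => x i ∈ A

/-- The reusable sample size `k`: the number of the samples `x i` that fall into `A`. -/
def reusableSize {E : Type*} (A : Set E) {p : ℕ} (x : Fin p → E) : ℕ :=
  (hitIndices A x).card

/-- The sample reuse function: the samples `z 0, …, z (n - 1)` obtained by listing first the
samples `x i ∈ A` in increasing order of `i` and then, from position `k = reusableSize A x` on,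
the fresh samples `y k, …, y (n - 1)` with the same position. -/
def reuse {E : Type*} (A : Set E) {p n : ℕ} (x : Fin p → E) (y : Fin n → E) : Fin n → E :=
  fun j =>
    if h : (j : ℕ) < reusableSize A x then x ((hitIndices A x).orderEmbOfFin rfl ⟨j, h⟩)
    else y j

/-- The samples used by the sample reuse algorithm on the sets `B 0 ⊇ B 1 ⊇ … ⊇ B m`, given the
raw samples `x ℓ i` for `B ℓ`: the raw samples are used for `B 0`, and the samples for
`B (ℓ + 1)` are obtained by the sample reuse function from the samples used for `B ℓ` and the
raw samples for `B (ℓ + 1)`. -/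
def usedSamples {E : Type*} {m N : ℕ} (B : Fin (m + 1) → Set E) (x : Fin (m + 1) → Fin N → E) :
    Fin (m + 1) → Fin N → E :=
  Fin.induction (motive := fun _ => Fin N → E) (x 0)
    fun ℓ z => reuse (B ℓ.succ) z (x ℓ.succ)

/-- The number of new simulations `N - k` needed for the set `B (ℓ + 1)`, where `k` is the number
of the samples used for `B ℓ` that fall into `B (ℓ + 1)`. -/
def newSimulations {E : Type*} {m N : ℕ} (B : Fin (m + 1) → Set E)
    (x : Fin (m + 1) → Fin N → E) (ℓ : Fin m) : ℕ :=
  N - reusableSize (B ℓ.succ) (usedSamples B x ℓ.castSucc)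

/-- The total number of new simulations, over all sets but the first one. -/
def totalNewSimulations {E : Type*} {m N : ℕ} (B : Fin (m + 1) → Set E)
    (x : Fin (m + 1) → Fin N → E) : ℕ :=
  ∑ ℓ : Fin m, newSimulations B x ℓ

/-- The setting of the sample reuse algorithm: nested Lebesgue measurable sets
`B 0 ⊇ B 1 ⊇ … ⊇ B m` in `ℝ ^ d`, the first of volume `Vmax` and the last of volume `Vmin`, and
mutually independent random vectors `X ℓ i`, `i < N`, uniformly distributed over `B ℓ`. -/
structure Setting {Ω : Type*} [MeasurableSpace Ω] (P : Measure Ω) {d m N : ℕ} (Vmax Vmin : ℝ)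
    (B : Fin (m + 1) → Set (EuclideanSpace ℝ (Fin d)))
    (X : Fin (m + 1) → Fin N → Ω → EuclideanSpace ℝ (Fin d)) : Prop where
  measurable : ∀ ℓ, NullMeasurableSet (B ℓ) volume
  nested : Antitone B
  volume_first : volume (B 0) = ENNReal.ofReal Vmax
  volume_last : volume (B (Fin.last m)) = ENNReal.ofReal Vmin
  uniform : ∀ ℓ i, pdf.IsUniform (X ℓ i) (B ℓ) P volume
  indep : iIndepFun (fun a : Fin (m + 1) × Fin N => X a.1 a.2) P

/-- The maximum difference of the volumes of two consecutive sets. -/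
def maxVolumeGap {d m : ℕ} (B : Fin (m + 1) → Set (EuclideanSpace ℝ (Fin d))) : ℝ :=
  ⨆ ℓ : Fin m, (volume.real (B ℓ.castSucc) - volume.real (B ℓ.succ))

end SampleReuse

end

-- Given `N` independent uniform samples on one set, condition on which of them hit the next set
-- `A`. The hits are then independent and uniform on `A`, and the missing places are filled by fresh
-- uniform samples. The output is thus again `N` independent uniform samples on `A`, whatever the
-- hit set was, hence independent of it (`map_hitIndices_prodMk_reuse`). By induction along the
-- sets, the numbers of new simulations are independent binomial variables
-- (`map_totalNewSimulations`).
--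
-- If consecutive volumes are `v ≥ v'`, a sample misses with probability `1 - v'/v = 1 - exp (-r)`,
-- where `r = log v - log v'`. This is the probability that a Poisson variable of mean `r` is
-- nonzero. So the total has the law of `∑ min (z ℓ i) 1` for an array of independent Poisson
-- variables `z ℓ i` of means `r ℓ` (`Setting.hasLaw_totalNewSimulations`), while `∑ z ℓ i` is
-- Poisson with the telescoping mean `N * log (Vmax / Vmin)` (`map_sum_poissonArray`).
--
-- Both claims are read off this coupling. The two sums vanish together, and the truncated one is
-- the smaller. It is at most `k` while the other exceeds `k` with positive probability, whence the
-- strict inequality. They differ only if some entry is at least 2, which has probability at most `N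
-- * ∑ r ℓ ^ 2 ≤ N * max r * log (Vmax / Vmin)`. Since `r ℓ` is at most the volume gap over `Vmin`,
-- this tends to zero.

namespace SampleReuse

open scoped NNReal ENNReal

-- Measurability of one reuse step

section Measurability

variable {E : Type*} [MeasurableSpace E] {A : Set E}

theorem mem_hitIndices {E : Type*} {A : Set E} {p : ℕ} {x : Fin p → E} {i : Fin p} :
    i ∈ hitIndices A x ↔ x i ∈ A := by
  simp [hitIndices]

theorem measurable_hitIndices (hA : MeasurableSet A) (p : ℕ) :
    Measurable (hitIndices A : (Fin p → E) → Finset (Fin p)) := by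
  rw [measurable_finset_iff]
  intro i
  simp only [mem_hitIndices]
  exact measurableSet_setOfPred.1 (measurable_pi_apply i hA)

theorem measurable_reusableSize (hA : MeasurableSet A) (p : ℕ) :
    Measurable (reusableSize A : (Fin p → E) → ℕ) :=
  (Measurable.of_discrete (f := Finset.card)).comp (measurable_hitIndices hA p)

/-- The sample reuse function for a prescribed set `s` of indices of reused samples. -/
def reuseAt {E : Type*} {p n : ℕ} (s : Finset (Fin p)) (x : Fin p → E) (y : Fin n → E) :
    Fin n → E :=
  fun j => if h : (j : ℕ) < s.card then x (s.orderEmbOfFin rfl ⟨j, h⟩) else y j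

theorem reuse_eq_reuseAt {E : Type*} (A : Set E) {p n : ℕ} (x : Fin p → E) (y : Fin n → E) :
    reuse A x y = reuseAt (hitIndices A x) x y := rfl

theorem measurable_reuseAt {p n : ℕ} (s : Finset (Fin p)) :
    Measurable fun w : (Fin p → E) × (Fin n → E) => reuseAt s w.1 w.2 := by
  refine measurable_pi_lambda _ fun j => ?_
  by_cases h : (j : ℕ) < s.card
  · simp only [reuseAt, h, dif_pos]; fun_prop
  · simp only [reuseAt, h, dif_neg, not_false_eq_true]; fun_prop

/-- The selected coordinates depend on the samples only through the hit set, which takes finitely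
many values; for each fixed value the map merely rearranges coordinates. -/
theorem measurable_reuse (hA : MeasurableSet A) (p n : ℕ) :
    Measurable fun w : (Fin p → E) × (Fin n → E) => reuse A w.1 w.2 := by
  have h : Measurable fun v : Finset (Fin p) × ((Fin p → E) × (Fin n → E)) =>
      reuseAt v.1 v.2.1 v.2.2 :=
    measurable_from_prod_countable_right fun s => measurable_reuseAt s
  exact h.comp (((measurable_hitIndices hA p).comp measurable_fst).prodMk measurable_id)

end Measurability

theorem prod_ite_lt_eq_prod_castLE {M : Type*} [CommMonoid M] {k n : ℕ} (h : k ≤ n)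
    (g : Fin n → M) :
    ∏ j : Fin n, (if (j : ℕ) < k then g j else 1) = ∏ j : Fin k, g (Fin.castLE h j) := by
  obtain ⟨l, rfl⟩ := Nat.exists_eq_add_of_le h
  rw [Fin.prod_univ_add]
  simp [Fin.castLE, Fin.castAdd]

-- One reuse step preserves independent uniform samples

section OneStep

variable {E : Type*} [MeasurableSpace E] {A : Set E} {N : ℕ}

open Classical in
theorem hitIndices_eq_iff {E : Type*} {A : Set E} {x : Fin N → E} {s : Finset (Fin N)} :
    hitIndices A x = s ↔ ∀ i, x i ∈ if i ∈ s then A else Aᶜ := by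
  rw [Finset.ext_iff]
  refine forall_congr' fun i => ?_
  rw [mem_hitIndices]
  by_cases h : i ∈ s <;> simp [h]

/-- The probability of a prescribed set of hit indices and of a box for the reused samples. -/
theorem prod_measure_hitIndices_eq_inter_reuse_box (hA : MeasurableSet A) (ν : Measure E)
    [IsProbabilityMeasure ν] (hν : ν A ≠ 0) (s : Finset (Fin N)) (C : Fin N → Set E) :
    ((Measure.pi fun _ : Fin N => ν).prod (Measure.pi fun _ : Fin N => ν[|A]))
        {w | hitIndices A w.1 = s ∧ reuse A w.1 w.2 ∈ Set.univ.pi C} =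
      (Measure.pi fun _ : Fin N => ν) {x | hitIndices A x = s} * ∏ j, ν[|A] (C j) := by
  classical
  have : IsProbabilityMeasure ν[|A] := cond_isProbabilityMeasure hν
  have hk : s.card ≤ N := by simpa using s.card_le_univ
  set e : Fin s.card ≃ s := (s.orderIsoOfFin rfl).toEquiv
  -- The event is a rectangle. A hit `x i` carries the constraint of the slot into which it is
  -- moved; a miss only has to avoid `A`. Fresh samples in slots taken by hits are discarded, hence
  -- unconstrained in `F`.
  let D : Fin N → Set E := fun i =>
    if h : i ∈ s then A ∩ C (Fin.castLE hk (e.symm ⟨i, h⟩)) else Aᶜ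
  let F : Fin N → Set E := fun j => if (j : ℕ) < s.card then Set.univ else C j
  have hset : {w : (Fin N → E) × (Fin N → E) |
      hitIndices A w.1 = s ∧ reuse A w.1 w.2 ∈ Set.univ.pi C} =
      (Set.univ.pi D) ×ˢ (Set.univ.pi F) := by
    ext ⟨x, y⟩
    simp only [Set.mem_ofPred_eq, Set.mem_prod, Set.mem_univ_pi]
    constructor
    · rintro ⟨h1, h2⟩
      rw [reuse_eq_reuseAt, h1] at h2
      rw [hitIndices_eq_iff] at h1
      constructor
      · intro i
        by_cases hi : i ∈ s
        · have h3 := h2 (Fin.castLE hk (e.symm ⟨i, hi⟩))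
          have h4 : s.orderEmbOfFin rfl (e.symm ⟨i, hi⟩) = i :=
            congrArg Subtype.val (e.apply_symm_apply ⟨i, hi⟩)
          simp only [reuseAt, Fin.val_castLE, Fin.is_lt, dif_pos, Fin.eta, h4] at h3
          have h5 := h1 i
          simp only [hi, if_true] at h5
          simp only [D, hi, dif_pos]
          exact ⟨h5, h3⟩
        · simpa [D, hi] using h1 i
      · intro j
        by_cases hj : (j : ℕ) < s.card
        · simp [F, hj]
        · simpa [F, hj, reuseAt] using h2 j
    · rintro ⟨h1, h2⟩
      have h0 : hitIndices A x = s := by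
        rw [hitIndices_eq_iff]
        intro i
        have := h1 i
        by_cases hi : i ∈ s
        · simp only [D, hi, dif_pos] at this
          simpa [hi] using this.1
        · simpa [D, hi] using this
      refine ⟨h0, fun j => ?_⟩
      rw [reuse_eq_reuseAt, h0]
      by_cases hj : (j : ℕ) < s.card
      · simp only [reuseAt, hj, dif_pos]
        have h3 : x (e ⟨j, hj⟩) ∈ A ∩ C (Fin.castLE hk (e.symm (e ⟨j, hj⟩))) := by
          have := h1 (e ⟨j, hj⟩)
          rwa [show D (e ⟨j, hj⟩) = _ from dif_pos (e ⟨j, hj⟩).2] at this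
        rw [Equiv.symm_apply_apply] at h3
        exact h3.2
      · simpa [F, hj, reuseAt] using h2 j
  have hset' : {x : Fin N → E | hitIndices A x = s} =
      Set.univ.pi fun i => if i ∈ s then A else Aᶜ := by
    ext x; simp [hitIndices_eq_iff]
  have hD : ∀ i, ν (D i) = ν (if i ∈ s then A else Aᶜ) *
      if h : i ∈ s then ν[|A] (C (Fin.castLE hk (e.symm ⟨i, h⟩))) else 1 := by
    intro i
    by_cases hi : i ∈ s
    · simp only [D, hi, dif_pos, if_true]
      rw [← cond_mul_eq_inter hA, mul_comm]
    · simp [D, hi]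
  -- Reindexing by the increasing enumeration of `s`: the hits supply exactly the factors of the
  -- first `s.card` slots, and `F` supplies the others.
  have hDprod : ∏ i, (if h : i ∈ s then ν[|A] (C (Fin.castLE hk (e.symm ⟨i, h⟩))) else 1) =
      ∏ j : Fin N, if (j : ℕ) < s.card then ν[|A] (C j) else 1 := by
    rw [prod_ite_lt_eq_prod_castLE hk, ← Equiv.prod_comp e.symm, Finset.prod_dite]
    simp only [Finset.prod_const_one, mul_one]
    refine Finset.prod_bij (fun i _ => ⟨i, (Finset.mem_filter.1 i.2).2⟩) ?_ ?_ ?_ ?_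
    · simp
    · intro a _ b _ h
      have h' : (a : Fin N) = b := congrArg (fun z : s => (z : Fin N)) h
      exact Subtype.ext h'
    · intro b _
      exact ⟨⟨b, by simp⟩, Finset.mem_attach _ _, rfl⟩
    · intro a _; rfl
  have hF : ∀ j, ν[|A] (F j) = if (j : ℕ) < s.card then 1 else ν[|A] (C j) := by
    intro j
    by_cases hj : (j : ℕ) < s.card <;> simp [F, hj]
  rw [hset, hset', Measure.prod_prod, Measure.pi_pi, Measure.pi_pi, Measure.pi_pi]
  simp only [hD, hF, Finset.prod_mul_distrib]
  rw [hDprod, mul_assoc, ← Finset.prod_mul_distrib]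
  congr 1
  refine Finset.prod_congr rfl fun j _ => ?_
  split_ifs <;> simp

/-- Boxes determine a product measure: the law of the output restricted to a given hit set, once
normalised, agrees with the product measure on boxes. A hit set of probability zero cannot be
normalised and is treated apart. -/
theorem prod_measure_hitIndices_eq_inter_reuse (hA : MeasurableSet A) (ν : Measure E)
    [IsProbabilityMeasure ν] (hν : ν A ≠ 0) (s : Finset (Fin N)) {C : Set (Fin N → E)}
    (hC : MeasurableSet C) :
    ((Measure.pi fun _ : Fin N => ν).prod (Measure.pi fun _ : Fin N => ν[|A]))
        {w | hitIndices A w.1 = s ∧ reuse A w.1 w.2 ∈ C} =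
      (Measure.pi fun _ : Fin N => ν) {x | hitIndices A x = s} *
        (Measure.pi fun _ : Fin N => ν[|A]) C := by
  have : IsProbabilityMeasure ν[|A] := cond_isProbabilityMeasure hν
  set ρ := (Measure.pi fun _ : Fin N => ν).prod (Measure.pi fun _ : Fin N => ν[|A])
  set c := (Measure.pi fun _ : Fin N => ν) {x | hitIndices A x = s}
  have hG : MeasurableSet {w : (Fin N → E) × (Fin N → E) | hitIndices A w.1 = s} :=
    (measurable_hitIndices hA N).comp measurable_fst (measurableSet_singleton s)
  have hreuse := measurable_reuse hA N N
  have hval : ∀ C : Set (Fin N → E), MeasurableSet C →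
      ((ρ.restrict {w | hitIndices A w.1 = s}).map fun w => reuse A w.1 w.2) C =
        ρ {w | hitIndices A w.1 = s ∧ reuse A w.1 w.2 ∈ C} := by
    intro C hC
    rw [Measure.map_apply hreuse hC, Measure.restrict_apply (hreuse hC), Set.inter_comm]
    rfl
  by_cases hc : c = 0
  · rw [hc, zero_mul]
    have h0 := prod_measure_hitIndices_eq_inter_reuse_box hA ν hν s (fun _ => Set.univ)
    refine measure_mono_null ?_ (h0.trans (mul_eq_zero_of_left hc _))
    rintro w ⟨h, -⟩
    exact ⟨h, by simp⟩
  · have hct : c ≠ ⊤ := measure_ne_top _ _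
    have h := Measure.pi_eq (μ := fun _ : Fin N => ν[|A])
      (μ' := c⁻¹ • (ρ.restrict {w | hitIndices A w.1 = s}).map fun w => reuse A w.1 w.2) (by
        intro D hD
        rw [Measure.smul_apply, hval _ (MeasurableSet.univ_pi hD),
          prod_measure_hitIndices_eq_inter_reuse_box hA ν hν s D, smul_eq_mul, ← mul_assoc,
          ENNReal.inv_mul_cancel hc hct, one_mul])
    rw [h, Measure.smul_apply, hval C hC, smul_eq_mul, ← mul_assoc, ENNReal.mul_inv_cancel hc hct,
      one_mul]

/-- The indices of the reused samples are independent of the samples produced by the sample reuse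
function, and the latter are again independent and identically distributed. -/
theorem map_hitIndices_prodMk_reuse (hA : MeasurableSet A) (ν : Measure E)
    [IsProbabilityMeasure ν] (hν : ν A ≠ 0) :
    (((Measure.pi fun _ : Fin N => ν).prod (Measure.pi fun _ : Fin N => ν[|A])).map
        fun w => (hitIndices A w.1, reuse A w.1 w.2)) =
      ((Measure.pi fun _ : Fin N => ν).map (hitIndices A)).prod
        (Measure.pi fun _ : Fin N => ν[|A]) := by
  have : IsProbabilityMeasure ν[|A] := cond_isProbabilityMeasure hν
  have hm := measurable_hitIndices hA N
  have hreuse := measurable_reuse hA N N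
  have : IsProbabilityMeasure ((Measure.pi fun _ : Fin N => ν).map (hitIndices A)) :=
    Measure.isProbabilityMeasure_map hm.aemeasurable
  symm
  refine Measure.prod_eq fun U C hU hC => ?_
  have hT : Measurable fun w : (Fin N → E) × (Fin N → E) =>
      (hitIndices A w.1, reuse A w.1 w.2) := (hm.comp measurable_fst).prodMk hreuse
  rw [Measure.map_apply hT (hU.prod hC), Measure.map_apply hm hU]
  set ρ := (Measure.pi fun _ : Fin N => ν).prod (Measure.pi fun _ : Fin N => ν[|A])
  have h1 : (fun w : (Fin N → E) × (Fin N → E) => (hitIndices A w.1, reuse A w.1 w.2)) ⁻¹'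
      (U ×ˢ C) = ⋃ s ∈ U.toFinite.toFinset,
        {w | hitIndices A w.1 = s ∧ reuse A w.1 w.2 ∈ C} := by
    ext w; simp
  have h2 : (hitIndices A : (Fin N → E) → Finset (Fin N)) ⁻¹' U =
      ⋃ s ∈ U.toFinite.toFinset, {x | hitIndices A x = s} := by
    ext w; simp
  rw [h1, h2, measure_biUnion_finset, measure_biUnion_finset, Finset.sum_mul]
  · exact Finset.sum_congr rfl fun s _ => prod_measure_hitIndices_eq_inter_reuse hA ν hν s hC
  · intro s _ t _ hst
    refine Set.disjoint_left.2 fun x hx hx' => hst ?_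
    exact Eq.trans (Eq.symm hx) hx'
  · exact fun s _ => hm (measurableSet_singleton s)
  · intro s _ t _ hst
    refine Set.disjoint_left.2 fun x hx hx' => hst ?_
    exact Eq.trans (Eq.symm hx.1) hx'.1
  · exact fun s _ => (hm.comp measurable_fst (measurableSet_singleton s)).inter (hreuse hC)

end OneStep

-- Recursion and causality of the algorithm

section Deterministic

variable {E : Type*} {m N : ℕ} (B : Fin (m + 1) → Set E)

theorem usedSamples_zero (x : Fin (m + 1) → Fin N → E) : usedSamples B x 0 = x 0 := by
  simp [usedSamples]

theorem usedSamples_succ (x : Fin (m + 1) → Fin N → E) (ℓ : Fin m) :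
    usedSamples B x ℓ.succ = reuse (B ℓ.succ) (usedSamples B x ℓ.castSucc) (x ℓ.succ) := by
  simp [usedSamples]

/-- Causality: no later raw sample is read. This makes the next row of raw samples independent of
the past. -/
theorem usedSamples_congr {x x' : Fin (m + 1) → Fin N → E} (r : Fin (m + 1))
    (h : ∀ a ≤ r, x a = x' a) : usedSamples B x r = usedSamples B x' r := by
  induction r using Fin.induction with
  | zero => rw [usedSamples_zero, usedSamples_zero, h 0 le_rfl]
  | succ ℓ ih =>
    rw [usedSamples_succ, usedSamples_succ, h _ le_rfl,
      ih fun a ha => h a (ha.trans ℓ.castSucc_lt_succ.le)]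

theorem newSimulations_congr {x x' : Fin (m + 1) → Fin N → E} (ℓ : Fin m)
    (h : ∀ a ≤ ℓ.castSucc, x a = x' a) : newSimulations B x ℓ = newSimulations B x' ℓ := by
  rw [newSimulations, newSimulations, usedSamples_congr B _ h]

/-- The number of new simulations for the sets `B 1, …, B r`. -/
noncomputable def partialNewSimulations (x : Fin (m + 1) → Fin N → E) (r : Fin (m + 1)) : ℕ :=
  ∑ ℓ : Fin m with ℓ.castSucc < r, newSimulations B x ℓ

theorem filter_castSucc_lt_succ (ℓ : Fin m) :
    (Finset.univ.filter fun k : Fin m => k.castSucc < ℓ.succ) =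
      insert ℓ (Finset.univ.filter fun k : Fin m => k.castSucc < ℓ.castSucc) := by
  ext k
  simp only [Finset.mem_filter, Finset.mem_univ, true_and, Finset.mem_insert, Fin.lt_def,
    Fin.ext_iff, Fin.val_castSucc, Fin.val_succ]
  omega

theorem partialNewSimulations_succ (x : Fin (m + 1) → Fin N → E) (ℓ : Fin m) :
    partialNewSimulations B x ℓ.succ =
      newSimulations B x ℓ + partialNewSimulations B x ℓ.castSucc := by
  rw [partialNewSimulations, filter_castSucc_lt_succ, Finset.sum_insert (by simp)]
  rfl

theorem partialNewSimulations_last (x : Fin (m + 1) → Fin N → E) :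
    partialNewSimulations B x (Fin.last m) = totalNewSimulations B x := by
  simp [partialNewSimulations, totalNewSimulations, Fin.castSucc_lt_last]

theorem partialNewSimulations_congr {x x' : Fin (m + 1) → Fin N → E} (r : Fin (m + 1))
    (h : ∀ a ≤ r, x a = x' a) : partialNewSimulations B x r = partialNewSimulations B x' r :=
  Finset.sum_congr rfl fun ℓ hℓ => newSimulations_congr B ℓ fun a ha =>
    h a (ha.trans (Finset.mem_filter.1 hℓ).2.le)

end Deterministic

section Measurability

variable {E : Type*} [MeasurableSpace E] {m N : ℕ} {B : Fin (m + 1) → Set E}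

theorem measurable_usedSamples (hB : ∀ ℓ, MeasurableSet (B ℓ)) (r : Fin (m + 1)) :
    Measurable fun x : Fin (m + 1) → Fin N → E => usedSamples B x r := by
  induction r using Fin.induction with
  | zero => simp only [usedSamples_zero]; fun_prop
  | succ ℓ ih =>
    simp only [usedSamples_succ]
    exact (measurable_reuse (hB ℓ.succ) N N).comp (ih.prodMk (measurable_pi_apply _))

theorem measurable_newSimulations (hB : ∀ ℓ, MeasurableSet (B ℓ)) (ℓ : Fin m) :
    Measurable fun x : Fin (m + 1) → Fin N → E => newSimulations B x ℓ :=
  (Measurable.of_discrete (f := fun k : ℕ => N - k)).comp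
    ((measurable_reusableSize (hB ℓ.succ) N).comp (measurable_usedSamples hB _))

theorem measurable_partialNewSimulations (hB : ∀ ℓ, MeasurableSet (B ℓ)) (r : Fin (m + 1)) :
    Measurable fun x : Fin (m + 1) → Fin N → E => partialNewSimulations B x r :=
  Finset.measurable_fun_sum _ fun ℓ _ => measurable_newSimulations hB ℓ

theorem measurable_totalNewSimulations (hB : ∀ ℓ, MeasurableSet (B ℓ)) :
    Measurable fun x : Fin (m + 1) → Fin N → E => totalNewSimulations B x :=
  Finset.measurable_fun_sum _ fun ℓ _ => measurable_newSimulations hB ℓ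

end Measurability

-- Independence of the numbers of new simulations

section JointLaw

variable {E : Type*} [MeasurableSpace E] {m N : ℕ} {B : Fin (m + 1) → Set E}
  {Ω : Type*} [MeasurableSpace Ω] {P : Measure Ω} [IsProbabilityMeasure P]
  {X : Fin (m + 1) → Fin N → Ω → E}

omit [IsProbabilityMeasure P] in
/-- The raw samples for one set are independent and identically distributed. -/
theorem map_row_eq_pi {u : Fin (m + 1) → Measure E} (hX : ∀ ℓ i, Measurable (X ℓ i))
    (hlaw : ∀ ℓ i, P.map (X ℓ i) = u ℓ)
    (hind : iIndepFun (fun a : Fin (m + 1) × Fin N => X a.1 a.2) P) (ℓ : Fin (m + 1)) :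
    P.map (fun ω i => X ℓ i ω) = Measure.pi fun _ : Fin N => u ℓ := by
  have h := hind.precomp (g := fun i : Fin N => (ℓ, i)) (fun i j h => (Prod.ext_iff.1 h).2)
  rw [iIndepFun.map_fun_eq_pi_map (fun i => (hX ℓ i).aemeasurable) h]
  simp only [hlaw]

/-- The raw samples for a set are independent of everything that the algorithm did before. -/
theorem indepFun_partial_row (hB : ∀ ℓ, MeasurableSet (B ℓ)) (hX : ∀ ℓ i, Measurable (X ℓ i))
    (hind : iIndepFun (fun a : Fin (m + 1) × Fin N => X a.1 a.2) P) (ℓ : Fin m) :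
    IndepFun
      (fun ω => (partialNewSimulations B (fun ℓ i => X ℓ i ω) ℓ.castSucc,
        usedSamples B (fun ℓ i => X ℓ i ω) ℓ.castSucc))
      (fun ω i => X ℓ.succ i ω) P := by
  classical
  let S : Finset (Fin (m + 1) × Fin N) := Finset.univ.filter fun a => a.1 ≤ ℓ.castSucc
  let T : Finset (Fin (m + 1) × Fin N) := Finset.univ.filter fun a => a.1 = ℓ.succ
  have hS : ∀ a i, (a, i) ∈ S ↔ a ≤ ℓ.castSucc := by simp [S]
  have hT : ∀ i, (ℓ.succ, i) ∈ T := by simp [T]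
  have hST : Disjoint S T := by
    rw [Finset.disjoint_left]
    rintro ⟨a, i⟩ h1 h2
    have h3 : a = ℓ.succ := by simpa [T] using h2
    exact absurd ((hS a i).1 h1) (by rw [h3]; exact not_le.2 ℓ.castSucc_lt_succ)
  have h := hind.indepFun_finset S T hST fun a => hX a.1 a.2
  rcases isEmpty_or_nonempty (Fin N) with hN | ⟨⟨i₀⟩⟩
  -- For `N = 0` there is no raw sample to serve as the default value needed below, but the row is
  -- constant.
  · have : Subsingleton (Fin N → E) := inferInstance
    exact (indepFun_const_right _ (fun i => isEmptyElim i : Fin N → E)).congr .rfl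
      (Eventually.of_forall fun ω => Subsingleton.elim _ _)
  -- The past is written as a function of the rows in `S` alone. Later rows are never read, so they
  -- are filled with an arbitrary entry of row 0, `E` not being assumed nonempty.
  · let ext : (S → E) → Fin (m + 1) → Fin N → E := fun w a i =>
      if h : (a, i) ∈ S then w ⟨(a, i), h⟩
      else w ⟨(0, i₀), (hS _ _).2 (Fin.zero_le _)⟩
    have hext : Measurable ext := by
      refine measurable_pi_lambda _ fun a => measurable_pi_lambda _ fun i => ?_
      by_cases h : (a, i) ∈ S
      · simp only [ext, h, dif_pos]; fun_prop
      · simp only [ext, h, dif_neg, not_false_eq_true]; fun_prop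
    have hφ : Measurable fun w : S → E => (partialNewSimulations B (ext w) ℓ.castSucc,
        usedSamples B (ext w) ℓ.castSucc) :=
      ((measurable_partialNewSimulations hB _).comp hext).prodMk
        ((measurable_usedSamples hB _).comp hext)
    have hψ : Measurable fun (w : T → E) (i : Fin N) => w ⟨(ℓ.succ, i), hT i⟩ := by fun_prop
    have h' := h.comp hφ hψ
    have hagree : ∀ ω, ∀ a ≤ ℓ.castSucc,
        ext (fun b : S => X b.1.1 b.1.2 ω) a = fun i => X a i ω := by
      intro ω a ha
      funext i
      simp [ext, (hS a i).2 ha]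
    refine h'.congr (Eventually.of_forall fun ω => ?_) .rfl
    simp only [Function.comp_apply]
    rw [partialNewSimulations_congr B _ (hagree ω), usedSamples_congr B _ (hagree ω)]

/-- The number of the new simulations for the sets `B 1, …, B r` is distributed as a sum of
independent variables and is independent of the samples used for `B r`, which are independent
and identically distributed. -/
theorem map_partialNewSimulations_prodMk_usedSamples (hB : ∀ ℓ, MeasurableSet (B ℓ))
    {u : Fin (m + 1) → Measure E} [∀ ℓ, IsProbabilityMeasure (u ℓ)]
    (hu : ∀ ℓ : Fin m, u ℓ.castSucc (B ℓ.succ) ≠ 0)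
    (hu' : ∀ ℓ : Fin m, (u ℓ.castSucc)[|B ℓ.succ] = u ℓ.succ)
    (hX : ∀ ℓ i, Measurable (X ℓ i)) (hlaw : ∀ ℓ i, P.map (X ℓ i) = u ℓ)
    (hind : iIndepFun (fun a : Fin (m + 1) × Fin N => X a.1 a.2) P)
    {Ω' : Type*} [MeasurableSpace Ω'] {Q : Measure Ω'} [IsProbabilityMeasure Q]
    {W : Fin m → Ω' → ℕ} (hW : ∀ ℓ, Measurable (W ℓ)) (hWind : iIndepFun W Q)
    (hWlaw : ∀ ℓ : Fin m, Q.map (W ℓ) =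
      (Measure.pi fun _ : Fin N => u ℓ.castSucc).map fun x => N - reusableSize (B ℓ.succ) x)
    (r : Fin (m + 1)) :
    P.map (fun ω => (partialNewSimulations B (fun ℓ i => X ℓ i ω) r,
        usedSamples B (fun ℓ i => X ℓ i ω) r)) =
      (Q.map (fun z => ∑ ℓ : Fin m with ℓ.castSucc < r, W ℓ z)).prod
        (Measure.pi fun _ : Fin N => u r) := by
  have hXm : Measurable fun ω => fun ℓ i => X ℓ i ω := by fun_prop
  induction r using Fin.induction with
  | zero =>
    simp only [partialNewSimulations, usedSamples_zero, Fin.not_lt_zero, Finset.filter_false,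
      Finset.sum_empty]
    rw [← map_row_eq_pi hX hlaw hind 0, Measure.map_const, measure_univ, one_smul,
      Measure.dirac_prod, Measure.map_map (by fun_prop) (by fun_prop)]
    rfl
  | succ ℓ ih =>
    set A := B ℓ.succ with hA
    set ν := u ℓ.castSucc with hν
    set τ := Q.map (fun z => ∑ k : Fin m with k.castSucc < ℓ.castSucc, W k z) with hτ
    have hWsum : ∀ s : Finset (Fin m), Measurable fun z => ∑ k ∈ s, W k z := fun s =>
      Finset.measurable_fun_sum _ fun k _ => hW k
    have : IsProbabilityMeasure τ := Measure.isProbabilityMeasure_map (hWsum _).aemeasurable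
    have hrow := map_row_eq_pi hX hlaw hind ℓ.succ
    have hmeas : Measurable fun ω => (partialNewSimulations B (fun ℓ i => X ℓ i ω) ℓ.castSucc,
        usedSamples B (fun ℓ i => X ℓ i ω) ℓ.castSucc) :=
      ((measurable_partialNewSimulations hB _).comp hXm).prodMk
        ((measurable_usedSamples hB _).comp hXm)
    have hmr : Measurable fun ω i => X ℓ.succ i ω := by fun_prop
    have hjoint := (indepFun_partial_row hB hX hind ℓ).map_prod_eq_prod_map_map
      hmeas.aemeasurable hmr.aemeasurable
    rw [ih, hrow, ← hu' ℓ] at hjoint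
    have hcond : IsProbabilityMeasure ν[|A] := cond_isProbabilityMeasure (hu ℓ)
    -- the transition of the algorithm, in two stages
    have hcount : Measurable fun p : Finset (Fin N) => N - p.card := .of_discrete
    let f : (ℕ × (Fin N → E)) × (Fin N → E) → ℕ × (Finset (Fin N) × (Fin N → E)) :=
      fun v => (v.1.1, (hitIndices A v.1.2, reuse A v.1.2 v.2))
    let g : ℕ × (Finset (Fin N) × (Fin N → E)) → ℕ × (Fin N → E) :=
      fun v => ((N - v.2.1.card) + v.1, v.2.2)
    have hhit := measurable_hitIndices (hB ℓ.succ) N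
    have hstep : Measurable fun w : (Fin N → E) × (Fin N → E) =>
        (hitIndices A w.1, reuse A w.1 w.2) :=
      (hhit.comp measurable_fst).prodMk (measurable_reuse (hB ℓ.succ) N N)
    have hf : Measurable f := by
      have : Measurable fun v : (ℕ × (Fin N → E)) × (Fin N → E) => (v.1.2, v.2) := by fun_prop
      exact (by fun_prop : Measurable fun v : (ℕ × (Fin N → E)) × (Fin N → E) => v.1.1).prodMk
        (hstep.comp this)
    have hg : Measurable g :=
      ((hcount.comp (by fun_prop : Measurable fun v : ℕ × (Finset (Fin N) × (Fin N → E)) =>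
        v.2.1)).add measurable_fst).prodMk (by fun_prop)
    have hfun : (fun ω => (partialNewSimulations B (fun ℓ i => X ℓ i ω) ℓ.succ,
        usedSamples B (fun ℓ i => X ℓ i ω) ℓ.succ)) = fun ω =>
        g (f ((partialNewSimulations B (fun ℓ i => X ℓ i ω) ℓ.castSucc,
          usedSamples B (fun ℓ i => X ℓ i ω) ℓ.castSucc), fun i => X ℓ.succ i ω)) := by
      funext ω
      rw [partialNewSimulations_succ, usedSamples_succ]
      rfl
    refine (congrArg P.map hfun).trans ((Measure.map_map (hg.comp hf) (hmeas.prodMk hmr)).symm.trans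
      ?_)
    rw [hjoint, ← Measure.map_map hg hf]
    -- The earlier count is a spectator: after reassociation, `f` is the identity on it times the
    -- one-step map.
    have hfmap : ((τ.prod (Measure.pi fun _ : Fin N => ν)).prod
        (Measure.pi fun _ : Fin N => ν[|A])).map f =
        τ.prod (((Measure.pi fun _ : Fin N => ν).map (hitIndices A)).prod
          (Measure.pi fun _ : Fin N => ν[|A])) := by
      rw [← map_hitIndices_prodMk_reuse (hB ℓ.succ) ν (hu ℓ)]
      have e1 : f = Prod.map id (fun w : (Fin N → E) × (Fin N → E) =>
        (hitIndices A w.1, reuse A w.1 w.2)) ∘ MeasurableEquiv.prodAssoc := rfl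
      rw [e1, ← Measure.map_map (measurable_id.prodMap hstep) MeasurableEquiv.prodAssoc.measurable,
        (measurePreserving_prodAssoc _ _ _).map_eq, ← Measure.map_prod_map _ _ measurable_id hstep,
        Measure.map_id]
    rw [hfmap]
    have hWW : IndepFun (fun z => ∑ k : Fin m with k.castSucc < ℓ.castSucc, W k z) (W ℓ) Q := by
      have := hWind.indepFun_finsetSum_of_notMem hW (i := ℓ)
        (s := Finset.univ.filter fun k : Fin m => k.castSucc < ℓ.castSucc) (by simp)
      convert this using 1
      funext z
      simp
    have hWj := hWW.map_prod_eq_prod_map_map (hWsum _).aemeasurable (hW ℓ).aemeasurable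
    have hsumfun : (fun z => ∑ k : Fin m with k.castSucc < ℓ.succ, W k z) =
        (fun p : ℕ × ℕ => p.2 + p.1) ∘
          fun z => (∑ k : Fin m with k.castSucc < ℓ.castSucc, W k z, W ℓ z) := by
      funext z
      rw [filter_castSucc_lt_succ, Finset.sum_insert (by simp)]
      rfl
    have hadd : Measurable fun p : ℕ × ℕ => p.2 + p.1 := .of_discrete
    have : IsProbabilityMeasure ((Measure.pi fun _ : Fin N => ν).map (hitIndices A)) :=
      Measure.isProbabilityMeasure_map hhit.aemeasurable
    have hmiss : (Measure.pi fun _ : Fin N => ν).map (fun x => N - reusableSize A x) =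
        ((Measure.pi fun _ : Fin N => ν).map (hitIndices A)).map (fun p => N - p.card) := by
      rw [Measure.map_map hcount hhit]; rfl
    have hga : Measurable fun v : ℕ × Finset (Fin N) => N - v.2.card + v.1 :=
      (hcount.comp measurable_snd).add measurable_fst
    rw [hsumfun, ← Measure.map_map hadd ((hWsum _).prodMk (hW ℓ)), hWj, hWlaw ℓ, hmiss,
      ← hτ, ← hu' ℓ]
    have e2 : g = Prod.map (fun v : ℕ × Finset (Fin N) => N - v.2.card + v.1) id ∘
        MeasurableEquiv.prodAssoc.symm := rfl
    rw [e2, ← Measure.map_map (hga.prodMap measurable_id)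
        MeasurableEquiv.prodAssoc.symm.measurable,
      ((measurePreserving_prodAssoc _ _ _).symm _).map_eq,
      ← Measure.map_prod_map _ _ hga measurable_id, Measure.map_id]
    congr 1
    have e3 : (fun v : ℕ × Finset (Fin N) => N - v.2.card + v.1) =
        (fun p : ℕ × ℕ => p.2 + p.1) ∘ Prod.map id (fun p : Finset (Fin N) => N - p.card) := rfl
    rw [e3, ← Measure.map_map hadd (measurable_id.prodMap hcount),
      ← Measure.map_prod_map _ _ measurable_id hcount, Measure.map_id]

/-- The total number of new simulations is distributed as a sum of independent variables. -/
theorem map_totalNewSimulations (hB : ∀ ℓ, MeasurableSet (B ℓ))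
    {u : Fin (m + 1) → Measure E} [∀ ℓ, IsProbabilityMeasure (u ℓ)]
    (hu : ∀ ℓ : Fin m, u ℓ.castSucc (B ℓ.succ) ≠ 0)
    (hu' : ∀ ℓ : Fin m, (u ℓ.castSucc)[|B ℓ.succ] = u ℓ.succ)
    (hX : ∀ ℓ i, Measurable (X ℓ i)) (hlaw : ∀ ℓ i, P.map (X ℓ i) = u ℓ)
    (hind : iIndepFun (fun a : Fin (m + 1) × Fin N => X a.1 a.2) P)
    {Ω' : Type*} [MeasurableSpace Ω'] {Q : Measure Ω'} [IsProbabilityMeasure Q]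
    {W : Fin m → Ω' → ℕ} (hW : ∀ ℓ, Measurable (W ℓ)) (hWind : iIndepFun W Q)
    (hWlaw : ∀ ℓ : Fin m, Q.map (W ℓ) =
      (Measure.pi fun _ : Fin N => u ℓ.castSucc).map fun x => N - reusableSize (B ℓ.succ) x) :
    P.map (fun ω => totalNewSimulations B (fun ℓ i => X ℓ i ω)) =
      Q.map (fun z => ∑ ℓ, W ℓ z) := by
  have h := congrArg (Measure.map Prod.fst) (map_partialNewSimulations_prodMk_usedSamples hB hu hu'
    hX hlaw hind hW hWind hWlaw (Fin.last m))
  have hXm : Measurable fun ω => fun ℓ i => X ℓ i ω := by fun_prop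
  have hm : Measurable fun ω => (partialNewSimulations B (fun ℓ i => X ℓ i ω) (Fin.last m),
      usedSamples B (fun ℓ i => X ℓ i ω) (Fin.last m)) :=
    ((measurable_partialNewSimulations hB _).comp hXm).prodMk
      ((measurable_usedSamples hB _).comp hXm)
  rw [Measure.map_map measurable_fst hm, Measure.map_fst_prod, measure_univ, one_smul] at h
  simpa [Function.comp_def, partialNewSimulations_last, Fin.castSucc_lt_last] using h

end JointLaw

-- Arrays of independent Poisson variables and their truncation

section Poisson

theorem poissonMeasure_singleton_zero (r : ℝ≥0) :
    poissonMeasure r {0} = ENNReal.ofReal (Real.exp (-r)) := by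
  simp [poissonMeasure_singleton]

theorem poissonMeasure_zero : poissonMeasure 0 = Measure.dirac 0 := by
  refine Measure.ext_of_singleton fun n => ?_
  rw [poissonMeasure_singleton, Measure.dirac_apply' _ (measurableSet_singleton n)]
  rcases n with _ | n <;> simp

theorem poissonMeasure_two_le (r : ℝ≥0) :
    poissonMeasure r {n | 2 ≤ n} ≤ ENNReal.ofReal ((r : ℝ) ^ 2) := by
  have hcompl : {n : ℕ | 2 ≤ n} = ((({0} ∪ {1} : Set ℕ)))ᶜ := by
    ext n
    simp only [Set.mem_ofPred_eq, Set.mem_compl_iff, Set.mem_union, Set.mem_singleton_iff]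
    omega
  have hreal : (poissonMeasure r).real {n | 2 ≤ n} =
      1 - (Real.exp (-r) + Real.exp (-r) * r) := by
    rw [hcompl, probReal_compl_eq_one_sub .of_discrete,
      measureReal_union (by simp) (measurableSet_singleton 1), poissonMeasure_real_singleton,
      poissonMeasure_real_singleton]
    simp
  rw [← ofReal_measureReal, hreal]
  refine ENNReal.ofReal_le_ofReal ?_
  -- From `exp (-r) ≥ 1 - r` follows `1 - (1 + r) * exp (-r) ≤ 1 - (1 + r) * (1 - r) = r ^ 2`.
  have h1 := Real.add_one_le_exp (-(r : ℝ))
  nlinarith [r.coe_nonneg]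

/-- A sum of independent Poisson variables is a Poisson variable. -/
theorem hasLaw_sum_poissonMeasure {Ω ι : Type*} [MeasurableSpace Ω] {P : Measure Ω}
    [IsProbabilityMeasure P] {Y : ι → Ω → ℕ} {r : ι → ℝ≥0} (hind : iIndepFun Y P)
    (hY : ∀ i, Measurable (Y i)) (hlaw : ∀ i, P.map (Y i) = poissonMeasure (r i))
    (s : Finset ι) : HasLaw (∑ i ∈ s, Y i) (poissonMeasure (∑ i ∈ s, r i)) P := by
  classical
  induction s using Finset.induction_on with
  | empty =>
    simp only [Finset.sum_empty, poissonMeasure_zero]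
    exact hasLaw_dirac_of_ae_eq (Eventually.of_forall fun _ => rfl)
  | insert i s hi ih =>
    rw [Finset.sum_insert hi, Finset.sum_insert hi]
    exact (hind.indepFun_finsetSum_of_notMem hY hi).symm.hasLaw_add_poissonMeasure
      ⟨(hY i).aemeasurable, hlaw i⟩ ih

/-- The law of a family of independent Poisson variables, with means depending on the row. -/
noncomputable def poissonArray {m : ℕ} (N : ℕ) (r : Fin m → ℝ≥0) :
    Measure (Fin m → Fin N → ℕ) :=
  Measure.pi fun ℓ => Measure.pi fun _ : Fin N => poissonMeasure (r ℓ)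

variable {m N : ℕ} (r : Fin m → ℝ≥0)

instance : IsProbabilityMeasure (poissonArray N r) := by
  unfold poissonArray; infer_instance

theorem map_sum_poissonArray :
    (poissonArray N r).map (fun z => ∑ ℓ, ∑ i, z ℓ i) = poissonMeasure (∑ ℓ, N * r ℓ) := by
  have hrow : ∀ ℓ, (Measure.pi fun _ : Fin N => poissonMeasure (r ℓ)).map (fun y => ∑ i, y i) =
      poissonMeasure (N * r ℓ) := by
    intro ℓ
    have h := hasLaw_sum_poissonMeasure (Y := fun (i : Fin N) (y : Fin N → ℕ) => y i)
      (r := fun _ => r ℓ) (P := Measure.pi fun _ : Fin N => poissonMeasure (r ℓ))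
      (iIndepFun_pi (X := fun _ => id) fun _ => aemeasurable_id)
      (fun i => measurable_pi_apply i) (fun i => (measurePreserving_eval _ i).map_eq) Finset.univ
    have h' := h.map_eq
    simp only [Finset.sum_const, Finset.card_univ, Fintype.card_fin, nsmul_eq_mul] at h'
    rw [← h']
    congr 1
    funext y
    simp
  have hsum : Measurable fun y : Fin N → ℕ => ∑ i, y i := by fun_prop
  have h := hasLaw_sum_poissonMeasure (Y := fun (ℓ : Fin m) (z : Fin m → Fin N → ℕ) => ∑ i, z ℓ i)
    (r := fun ℓ => N * r ℓ) (P := poissonArray N r)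
    (iIndepFun_pi (X := fun _ (y : Fin N → ℕ) => ∑ i, y i) fun _ => hsum.aemeasurable)
    (fun ℓ => by fun_prop) (fun ℓ => by
      rw [← hrow ℓ, ← (measurePreserving_eval
        (fun ℓ => Measure.pi fun _ : Fin N => poissonMeasure (r ℓ)) ℓ).map_eq,
        Measure.map_map hsum (measurable_pi_apply ℓ)]
      rfl) Finset.univ
  rw [← h.map_eq]
  congr 1
  funext z
  simp

theorem sum_min_le_sum (z : Fin m → Fin N → ℕ) :
    ∑ ℓ, ∑ i, min (z ℓ i) 1 ≤ ∑ ℓ, ∑ i, z ℓ i :=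
  Finset.sum_le_sum fun _ _ => Finset.sum_le_sum fun _ _ => min_le_left _ _

theorem sum_min_eq_zero_iff (z : Fin m → Fin N → ℕ) :
    ∑ ℓ, ∑ i, min (z ℓ i) 1 = 0 ↔ ∑ ℓ, ∑ i, z ℓ i = 0 := by
  simp

/-- Rows of rate zero occur when consecutive sets have equal volume; they charge only the value 0,
hence the hypothesis. -/
theorem poissonArray_singleton_pos (w : Fin m → Fin N → ℕ) (h : ∀ ℓ i, w ℓ i ≠ 0 → 0 < r ℓ) :
    poissonArray N r {w} ≠ 0 := by
  rw [poissonArray, Measure.pi_singleton]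
  refine Finset.prod_ne_zero_iff.2 fun ℓ _ => ?_
  rw [Measure.pi_singleton]
  refine Finset.prod_ne_zero_iff.2 fun i _ => ?_
  by_cases hw : w ℓ i = 0
  · rw [hw, poissonMeasure_singleton_zero]
    simpa using Real.exp_pos _
  · rw [poissonMeasure_singleton]
    have := h ℓ i hw
    simp only [ne_eq, ENNReal.ofReal_eq_zero, not_le]
    positivity

/-- The number of nonzero entries of a nondegenerate Poisson array is strictly smaller in the
stochastic order than their sum. -/
theorem poissonArray_sum_le_lt (hN : 1 ≤ N) {ℓ₀ : Fin m} (hr : 0 < r ℓ₀) {k : ℕ} (hk : 1 ≤ k) :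
    poissonArray N r {z | ∑ ℓ, ∑ i, z ℓ i ≤ k} <
      poissonArray N r {z | ∑ ℓ, ∑ i, min (z ℓ i) 1 ≤ k} := by
  let i₀ : Fin N := ⟨0, hN⟩
  -- A single entry `k + 1` makes the sum exceed `k`, while only one entry is nonzero and `1 ≤ k`.
  let w : Fin m → Fin N → ℕ := fun ℓ i => if ℓ = ℓ₀ then if i = i₀ then k + 1 else 0 else 0
  have hw : poissonArray N r {w} ≠ 0 := by
    refine poissonArray_singleton_pos r w fun ℓ i h => ?_
    by_cases hℓ : ℓ = ℓ₀
    · rwa [hℓ]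
    · simp [w, hℓ] at h
  have hw1 : ∑ ℓ, ∑ i, w ℓ i = k + 1 := by
    rw [Finset.sum_eq_single ℓ₀ (fun ℓ _ h => by simp [w, h]) (by simp)]
    simp [w]
  have hw2 : ∑ ℓ, ∑ i, min (w ℓ i) 1 = 1 := by
    rw [Finset.sum_eq_single ℓ₀ (fun ℓ _ h => by simp [w, h]) (by simp),
      Finset.sum_eq_single i₀ (fun i _ h => by simp [w, h]) (by simp)]
    simp [w]
  have hdisj : Disjoint {z : Fin m → Fin N → ℕ | ∑ ℓ, ∑ i, z ℓ i ≤ k} {w} := by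
    rw [Set.disjoint_singleton_right]
    intro h
    have h' : ∑ ℓ, ∑ i, w ℓ i ≤ k := h
    omega
  have hsub : {z : Fin m → Fin N → ℕ | ∑ ℓ, ∑ i, z ℓ i ≤ k} ∪ {w} ⊆
      {z | ∑ ℓ, ∑ i, min (z ℓ i) 1 ≤ k} := by
    rintro z (h | h)
    · exact (sum_min_le_sum z).trans h
    · rw [Set.mem_singleton_iff] at h
      rw [h]
      exact hw2.le.trans hk
  calc poissonArray N r {z | ∑ ℓ, ∑ i, z ℓ i ≤ k}
      < poissonArray N r {z | ∑ ℓ, ∑ i, z ℓ i ≤ k} + poissonArray N r {w} :=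
        ENNReal.lt_add_right (measure_ne_top _ _) hw
    _ = poissonArray N r ({z | ∑ ℓ, ∑ i, z ℓ i ≤ k} ∪ {w}) :=
        (measure_union hdisj (measurableSet_singleton w)).symm
    _ ≤ _ := measure_mono hsub

/-- The number of nonzero entries of a Poisson array rarely differs from their sum. -/
theorem poissonArray_sum_min_ne_sum_le :
    poissonArray N r {z | ∑ ℓ, ∑ i, min (z ℓ i) 1 ≠ ∑ ℓ, ∑ i, z ℓ i} ≤
      ∑ ℓ, N * ENNReal.ofReal ((r ℓ : ℝ) ^ 2) := by
  -- Truncation changes the sum only if some entry is at least 2; then a union bound.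
  have hsub : {z : Fin m → Fin N → ℕ | ∑ ℓ, ∑ i, min (z ℓ i) 1 ≠ ∑ ℓ, ∑ i, z ℓ i} ⊆
      ⋃ ℓ ∈ Finset.univ, ⋃ i ∈ Finset.univ, {z | 2 ≤ z ℓ i} := by
    intro z hz
    by_contra hcon
    simp only [Finset.mem_univ, Set.iUnion_true, Set.mem_iUnion, Set.mem_ofPred_eq, not_exists,
      not_le] at hcon
    refine hz (Finset.sum_congr rfl fun ℓ _ => Finset.sum_congr rfl fun i _ => ?_)
    have := hcon ℓ i
    omega
  refine (measure_mono hsub).trans ((measure_biUnion_finset_le _ _).trans ?_)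
  refine Finset.sum_le_sum fun ℓ _ => (measure_biUnion_finset_le _ _).trans ?_
  refine (Finset.sum_le_card_nsmul _ _ (ENNReal.ofReal ((r ℓ : ℝ) ^ 2)) fun i _ => ?_).trans
    (by simp)
  have h2 : MeasurableSet {y : Fin N → ℕ | 2 ≤ y i} :=
    measurable_pi_apply i (MeasurableSet.of_discrete (s := {n : ℕ | 2 ≤ n}))
  have e1 := (measurePreserving_eval (fun ℓ => Measure.pi fun _ : Fin N => poissonMeasure (r ℓ))
    ℓ).measure_preimage h2.nullMeasurableSet
  have e2 := (measurePreserving_eval (fun _ : Fin N => poissonMeasure (r ℓ)) i).measure_preimage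
    (MeasurableSet.of_discrete (s := {n : ℕ | 2 ≤ n})).nullMeasurableSet
  exact (e1.trans e2).trans_le (poissonMeasure_two_le (r ℓ))

end Poisson

-- Misses as truncated Poisson variables

section Misses

variable {E : Type*} [MeasurableSpace E] {A : Set E} {N : ℕ}

open Classical in
theorem sub_reusableSize_eq_sum {E : Type*} (A : Set E) (x : Fin N → E) :
    N - reusableSize A x = ∑ i, if x i ∈ A then 0 else 1 := by
  have h := Finset.card_filter_add_card_filter_not (s := (Finset.univ : Finset (Fin N)))
    (fun i => x i ∈ A)
  rw [Finset.sum_ite, reusableSize, hitIndices]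
  simp at h ⊢
  omega

open Classical in
-- Both sides are Bernoulli laws, and `r` is chosen so that a hit is as likely as a Poisson value 0.
theorem map_miss_eq_map_min (hA : MeasurableSet A) (ν : Measure E) [IsProbabilityMeasure ν]
    {r : ℝ≥0} (hν : ν A = ENNReal.ofReal (Real.exp (-r))) :
    ν.map (fun x => if x ∈ A then 0 else 1) = (poissonMeasure r).map fun n => min n 1 := by
  have hf : Measurable fun x : E => if x ∈ A then 0 else 1 :=
    Measurable.ite hA measurable_const measurable_const
  have hg : Measurable fun n : ℕ => min n 1 := .of_discrete
  refine Measure.ext_of_singleton fun n => ?_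
  rw [Measure.map_apply hf (measurableSet_singleton n),
    Measure.map_apply hg (measurableSet_singleton n)]
  match n with
  | 0 =>
    have e1 : (fun x : E => if x ∈ A then 0 else 1) ⁻¹' {0} = A := by ext x; simp
    have e2 : (fun n : ℕ => min n 1) ⁻¹' {0} = {0} := by ext n; simp
    rw [e1, e2, hν, poissonMeasure_singleton_zero]
  | 1 =>
    have e1 : (fun x : E => if x ∈ A then 0 else 1) ⁻¹' {1} = Aᶜ := by ext x; simp
    have e2 : (fun n : ℕ => min n 1) ⁻¹' {1} = {0}ᶜ := by ext n; simp; omega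
    rw [e1, e2, prob_compl_eq_one_sub hA, prob_compl_eq_one_sub (measurableSet_singleton 0), hν,
      poissonMeasure_singleton_zero]
  | n + 2 =>
    have e1 : (fun x : E => if x ∈ A then 0 else 1) ⁻¹' {n + 2} = ∅ := by
      ext x; by_cases h : x ∈ A <;> simp [h]
    have e2 : (fun n : ℕ => min n 1) ⁻¹' {n + 2} = ∅ := by ext k; simp; omega
    rw [e1, e2, measure_empty, measure_empty]

/-- The number of missed samples is distributed as the number of nonzero ones among independent
Poisson variables. -/
theorem map_sub_reusableSize (hA : MeasurableSet A) (ν : Measure E) [IsProbabilityMeasure ν]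
    {r : ℝ≥0} (hν : ν A = ENNReal.ofReal (Real.exp (-r))) :
    (Measure.pi fun _ : Fin N => ν).map (fun x => N - reusableSize A x) =
      (Measure.pi fun _ : Fin N => poissonMeasure r).map fun y => ∑ i, min (y i) 1 := by
  classical
  have hf : Measurable fun x : E => if x ∈ A then 0 else 1 :=
    Measurable.ite hA measurable_const measurable_const
  have hg : Measurable fun n : ℕ => min n 1 := .of_discrete
  have hsum : Measurable fun y : Fin N → ℕ => ∑ i, y i := by fun_prop
  have : IsProbabilityMeasure (ν.map fun x : E => if x ∈ A then 0 else 1) :=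
    Measure.isProbabilityMeasure_map hf.aemeasurable
  have h1 := Measure.pi_map_pi (μ := fun _ : Fin N => ν)
    (f := fun _ x => if x ∈ A then 0 else 1) fun _ => hf.aemeasurable
  have : IsProbabilityMeasure ((poissonMeasure r).map fun n => min n 1) :=
    Measure.isProbabilityMeasure_map hg.aemeasurable
  have h2 := Measure.pi_map_pi (μ := fun _ : Fin N => poissonMeasure r)
    (f := fun _ n => min n 1) fun _ => hg.aemeasurable
  have h3 := congrArg (Measure.map fun y : Fin N → ℕ => ∑ i, y i)
    (h1.trans ((by rw [map_miss_eq_map_min hA ν hν] : _ = _).trans h2.symm))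
  have hfm : Measurable fun (x : Fin N → E) (i : Fin N) => if x i ∈ A then 0 else 1 :=
    measurable_pi_lambda _ fun i => hf.comp (measurable_pi_apply i)
  have hgm : Measurable fun (y : Fin N → ℕ) (i : Fin N) => min (y i) 1 :=
    measurable_pi_lambda _ fun i => hg.comp (measurable_pi_apply i)
  rw [Measure.map_map hsum hfm, Measure.map_map hsum hgm] at h3
  simpa only [Function.comp_def, ← sub_reusableSize_eq_sum] using h3

end Misses

-- Insensitivity to null modifications of the sets

section Congruence

variable {E : Type*} {m N : ℕ}

theorem hitIndices_congr {A A' : Set E} {x : Fin N → E} (h : ∀ i, x i ∈ A ↔ x i ∈ A') :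
    hitIndices A x = hitIndices A' x := by
  ext i; simp [mem_hitIndices, h]

/-- Reuse only copies raw samples, so sets that the raw samples do not distinguish give the same
run. -/
theorem exists_usedSamples_eq (B : Fin (m + 1) → Set E) (x : Fin (m + 1) → Fin N → E)
    (r : Fin (m + 1)) (i : Fin N) : ∃ ℓ j, usedSamples B x r i = x ℓ j := by
  induction r using Fin.induction generalizing i with
  | zero => exact ⟨0, i, by rw [usedSamples_zero]⟩
  | succ k ih =>
    rw [usedSamples_succ, reuse]
    split_ifs with h
    · exact ih _
    · exact ⟨_, _, rfl⟩

variable {B B' : Fin (m + 1) → Set E} {x : Fin (m + 1) → Fin N → E}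

theorem usedSamples_congr_sets (h : ∀ k ℓ i, x ℓ i ∈ B k ↔ x ℓ i ∈ B' k) (r : Fin (m + 1)) :
    usedSamples B x r = usedSamples B' x r := by
  induction r using Fin.induction with
  | zero => rw [usedSamples_zero, usedSamples_zero]
  | succ k ih =>
    have hhit : hitIndices (B k.succ) (usedSamples B' x k.castSucc) =
        hitIndices (B' k.succ) (usedSamples B' x k.castSucc) := by
      refine hitIndices_congr fun i => ?_
      obtain ⟨ℓ, j, hj⟩ := exists_usedSamples_eq B' x k.castSucc i
      rw [hj]
      exact h _ _ _
    rw [usedSamples_succ, usedSamples_succ, ih, reuse_eq_reuseAt, reuse_eq_reuseAt, hhit]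

theorem totalNewSimulations_congr_sets (h : ∀ k ℓ i, x ℓ i ∈ B k ↔ x ℓ i ∈ B' k) :
    totalNewSimulations B x = totalNewSimulations B' x := by
  refine Finset.sum_congr rfl fun k _ => ?_
  rw [newSimulations, newSimulations, usedSamples_congr_sets h, reusableSize, reusableSize]
  congr 2
  refine hitIndices_congr fun i => ?_
  obtain ⟨ℓ, j, hj⟩ := exists_usedSamples_eq B' x k.castSucc i
  rw [hj]
  exact h _ _ _

end Congruence

theorem cond_congr_set {E : Type*} [MeasurableSpace E] {μ : Measure E} {s t : Set E}
    (h : s =ᵐ[μ] t) : μ[|s] = μ[|t] := by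
  rw [ProbabilityTheory.cond, ProbabilityTheory.cond, measure_congr h, Measure.restrict_congr_set h]

theorem sum_castSucc_sub_succ {m : ℕ} (f : Fin (m + 1) → ℝ) :
    ∑ ℓ : Fin m, (f ℓ.castSucc - f ℓ.succ) = f 0 - f (Fin.last m) := by
  have h1 := Fin.sum_univ_succ f
  have h2 := Fin.sum_univ_castSucc f
  rw [Finset.sum_sub_distrib]
  linarith

/-- The mean of the Poisson variable attached to the transition from `B ℓ` to `B (ℓ + 1)`. -/
noncomputable def rate {d m : ℕ} (B : Fin (m + 1) → Set (EuclideanSpace ℝ (Fin d))) (ℓ : Fin m) :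
    ℝ≥0 :=
  Real.toNNReal (Real.log (volume.real (B ℓ.castSucc)) - Real.log (volume.real (B ℓ.succ)))

-- Rates and the law of the total in the geometric setting

namespace Setting

variable {Ω : Type*} [MeasurableSpace Ω] {P : Measure Ω} {d m N : ℕ} {Vmax Vmin : ℝ}
  {B : Fin (m + 1) → Set (EuclideanSpace ℝ (Fin d))}
  {X : Fin (m + 1) → Fin N → Ω → EuclideanSpace ℝ (Fin d)}

theorem volume_ne_top (h : Setting P Vmax Vmin B X) (ℓ : Fin (m + 1)) : volume (B ℓ) ≠ ⊤ :=
  ((measure_mono (h.nested (Fin.zero_le ℓ))).trans_lt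
    (h.volume_first ▸ ENNReal.ofReal_lt_top)).ne

theorem real_first (h : Setting P Vmax Vmin B X) (hV : 0 ≤ Vmax) :
    volume.real (B 0) = Vmax := by
  rw [measureReal_def, h.volume_first, ENNReal.toReal_ofReal hV]

theorem real_last (h : Setting P Vmax Vmin B X) (hV : 0 ≤ Vmin) :
    volume.real (B (Fin.last m)) = Vmin := by
  rw [measureReal_def, h.volume_last, ENNReal.toReal_ofReal hV]

theorem real_antitone (h : Setting P Vmax Vmin B X) : Antitone fun ℓ => volume.real (B ℓ) :=
  fun a _ hab => measureReal_mono (h.nested hab) (h.volume_ne_top a)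

theorem le_real (h : Setting P Vmax Vmin B X) (hV : 0 ≤ Vmin) (ℓ : Fin (m + 1)) :
    Vmin ≤ volume.real (B ℓ) :=
  (h.real_last hV).symm.le.trans (h.real_antitone (Fin.le_last ℓ))

theorem coe_rate (h : Setting P Vmax Vmin B X) (hV : 0 < Vmin) (ℓ : Fin m) :
    (rate B ℓ : ℝ) =
      Real.log (volume.real (B ℓ.castSucc)) - Real.log (volume.real (B ℓ.succ)) := by
  rw [rate, Real.coe_toNNReal _ (sub_nonneg.2 (Real.log_le_log
    (hV.trans_le (h.le_real hV.le _)) (h.real_antitone ℓ.castSucc_lt_succ.le)))]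

theorem sum_rate (h : Setting P Vmax Vmin B X) (hV : 0 < Vmin) (hV' : Vmin < Vmax) :
    ∑ ℓ, (rate B ℓ : ℝ) = Real.log (Vmax / Vmin) := by
  simp only [h.coe_rate hV]
  rw [sum_castSucc_sub_succ fun ℓ => Real.log (volume.real (B ℓ)),
    h.real_first (hV.trans hV').le, h.real_last hV.le,
    Real.log_div (hV.trans hV').ne' hV.ne']

theorem sum_mul_rate (h : Setting P Vmax Vmin B X) (hV : 0 < Vmin) (hV' : Vmin < Vmax) :
    ∑ ℓ, N * rate B ℓ = Real.toNNReal (N * Real.log (Vmax / Vmin)) := by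
  rw [← h.sum_rate hV hV', ← Finset.mul_sum]
  refine NNReal.coe_injective ?_
  rw [Real.coe_toNNReal _ (by positivity)]
  push_cast
  rfl

/-- The rates sum to `log (Vmax / Vmin) > 0`. The positive one yields the strict inequality of the
main theorem. -/
theorem exists_rate_pos (h : Setting P Vmax Vmin B X) (hV : 0 < Vmin) (hV' : Vmin < Vmax) :
    ∃ ℓ, 0 < rate B ℓ := by
  by_contra hcon
  have h0 : ∀ ℓ, rate B ℓ = 0 := by simpa using hcon
  have h1 := h.sum_rate hV hV'
  simp only [h0, NNReal.coe_zero, Finset.sum_const_zero] at h1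
  exact absurd h1 (Real.log_pos ((one_lt_div hV).2 hV')).ne

theorem rate_le (h : Setting P Vmax Vmin B X) (hV : 0 < Vmin) (ℓ : Fin m) :
    (rate B ℓ : ℝ) ≤ maxVolumeGap B / Vmin := by
  have hpos : ∀ k, 0 < volume.real (B k) := fun k => hV.trans_le (h.le_real hV.le k)
  have hgap : volume.real (B ℓ.castSucc) - volume.real (B ℓ.succ) ≤ maxVolumeGap B :=
    le_ciSup (f := fun ℓ : Fin m => volume.real (B ℓ.castSucc) - volume.real (B ℓ.succ))
      (Set.finite_range _).bddAbove ℓ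
  have hnonneg : 0 ≤ volume.real (B ℓ.castSucc) - volume.real (B ℓ.succ) :=
    sub_nonneg.2 (h.real_antitone ℓ.castSucc_lt_succ.le)
  rw [h.coe_rate hV, ← Real.log_div (hpos _).ne' (hpos _).ne']
  calc Real.log (volume.real (B ℓ.castSucc) / volume.real (B ℓ.succ))
      ≤ volume.real (B ℓ.castSucc) / volume.real (B ℓ.succ) - 1 :=
        Real.log_le_sub_one_of_pos (div_pos (hpos _) (hpos _))
    _ = (volume.real (B ℓ.castSucc) - volume.real (B ℓ.succ)) / volume.real (B ℓ.succ) := by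
        rw [sub_div, div_self (hpos _).ne']
    _ ≤ _ := div_le_div₀ (hnonneg.trans hgap) hgap hV (h.le_real hV.le _)

/-- The total number of new simulations is distributed as the number of nonzero variables in an
array of independent Poisson variables. -/
theorem hasLaw_totalNewSimulations [IsProbabilityMeasure P] (h : Setting P Vmax Vmin B X)
    (hV : 0 < Vmin) :
    HasLaw (fun ω => totalNewSimulations B (fun ℓ i => X ℓ i ω))
      ((poissonArray N (rate B)).map fun z => ∑ ℓ, ∑ i, min (z ℓ i) 1) P := by
  have hpos : ∀ k, 0 < volume.real (B k) := fun k => hV.trans_le (h.le_real hV.le k)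
  have hne : ∀ k, volume (B k) ≠ 0 := fun k h0 => (hpos k).ne' (by simp [measureReal_def, h0])
  -- The sets are only null measurable and the samples only a.e. measurable, so both are replaced by
  -- measurable versions. The new sets are nested only up to null sets, which is enough for the
  -- conditioning identity `hu'`.
  choose B' _ hB' hBB' using fun ℓ => (h.measurable ℓ).exists_measurable_superset_ae_eq
  have hXm : ∀ ℓ i, AEMeasurable (X ℓ i) P := fun ℓ i =>
    (h.uniform ℓ i).aemeasurable (hne ℓ) (h.volume_ne_top ℓ)
  let X' : Fin (m + 1) → Fin N → Ω → EuclideanSpace ℝ (Fin d) := fun ℓ i => (hXm ℓ i).mk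
  have hX' : ∀ ℓ i, Measurable (X' ℓ i) := fun ℓ i => (hXm ℓ i).measurable_mk
  have hXX' : ∀ ℓ i, X ℓ i =ᵐ[P] X' ℓ i := fun ℓ i => (hXm ℓ i).ae_eq_mk
  let u : Fin (m + 1) → Measure (EuclideanSpace ℝ (Fin d)) := fun ℓ => volume[|B ℓ]
  have hu : ∀ ℓ, IsProbabilityMeasure (u ℓ) := fun ℓ =>
    cond_isProbabilityMeasure_of_finite (hne ℓ) (h.volume_ne_top ℓ)
  have hinter : ∀ ℓ : Fin m, (B' ℓ.castSucc ∩ B' ℓ.succ : Set _) =ᵐ[volume] B ℓ.succ := by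
    intro ℓ
    have := (hBB' ℓ.castSucc).inter (hBB' ℓ.succ)
    rwa [Set.inter_eq_right.2 (h.nested ℓ.castSucc_lt_succ.le)] at this
  have hu' : ∀ ℓ : Fin m, (u ℓ.castSucc)[|B' ℓ.succ] = u ℓ.succ := by
    intro ℓ
    change (volume[|B ℓ.castSucc])[|B' ℓ.succ] = volume[|B ℓ.succ]
    rw [← cond_congr_set (hBB' ℓ.castSucc), cond_cond_eq_cond_inter' (hB' _) (hB' _)
      (by rw [measure_congr (hBB' _)]; exact h.volume_ne_top _), cond_congr_set (hinter ℓ)]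
  have huB : ∀ ℓ : Fin m,
      u ℓ.castSucc (B' ℓ.succ) = ENNReal.ofReal (Real.exp (-(rate B ℓ : ℝ))) := by
    intro ℓ
    change (volume[|B ℓ.castSucc]) (B' ℓ.succ) = _
    rw [← cond_congr_set (hBB' ℓ.castSucc), cond_apply (hB' _), measure_congr (hinter ℓ),
      measure_congr (hBB' _), h.coe_rate hV, neg_sub, Real.exp_sub, Real.exp_log (hpos _),
      Real.exp_log (hpos _), ENNReal.ofReal_div_of_pos (hpos _),
      ofReal_measureReal (h.volume_ne_top _), ofReal_measureReal (h.volume_ne_top _),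
      ENNReal.div_eq_inv_mul]
  have hlaw : ∀ ℓ i, P.map (X' ℓ i) = u ℓ := fun ℓ i => by
    rw [← Measure.map_congr (hXX' ℓ i)]
    exact h.uniform ℓ i
  have hind : iIndepFun (fun a : Fin (m + 1) × Fin N => X' a.1 a.2) P :=
    h.indep.congr fun a => hXX' a.1 a.2
  have hsum : Measurable fun y : Fin N → ℕ => ∑ i, min (y i) 1 := by fun_prop
  have hmap := map_totalNewSimulations (u := u) (Q := poissonArray N (rate B))
    (W := fun ℓ z => ∑ i, min (z ℓ i) 1) hB'
    (fun ℓ => by rw [huB]; simpa using Real.exp_pos _) hu' hX' hlaw hind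
    (fun ℓ => by fun_prop)
    (iIndepFun_pi (X := fun _ (y : Fin N → ℕ) => ∑ i, min (y i) 1) fun _ => hsum.aemeasurable)
    (fun ℓ => by
      rw [map_sub_reusableSize (hB' _) _ (huB ℓ), ← (measurePreserving_eval
        (fun ℓ => Measure.pi fun _ : Fin N => poissonMeasure (rate B ℓ)) ℓ).map_eq,
        Measure.map_map hsum (measurable_pi_apply ℓ)]
      rfl)
  have hX'm : Measurable fun ω => fun ℓ i => X' ℓ i ω := by fun_prop
  have hlaw' : HasLaw (fun ω => totalNewSimulations B' (fun ℓ i => X' ℓ i ω))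
      ((poissonArray N (rate B)).map fun z => ∑ ℓ, ∑ i, min (z ℓ i) 1) P :=
    ⟨((measurable_totalNewSimulations hB').comp hX'm).aemeasurable, hmap⟩
  refine hlaw'.congr ?_
  have h1 : ∀ᵐ ω ∂P, ∀ ℓ i, X ℓ i ω = X' ℓ i ω :=
    ae_all_iff.2 fun ℓ => ae_all_iff.2 fun i => hXX' ℓ i
  -- Uniform laws are absolutely continuous, so almost surely no raw sample falls where some `B k`
  -- and `B' k` differ.
  have h2 : ∀ᵐ ω ∂P, ∀ k ℓ i, X ℓ i ω ∈ B k ↔ X ℓ i ω ∈ B' k := by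
    refine ae_all_iff.2 fun k => ae_all_iff.2 fun ℓ => ae_all_iff.2 fun i => ?_
    have hk : ∀ᵐ x ∂volume, x ∈ B k ↔ x ∈ B' k := (hBB' k).symm.mem_iff
    exact ae_of_ae_map (p := fun x => x ∈ B k ↔ x ∈ B' k) (hXm ℓ i)
      ((h.uniform ℓ i).absolutelyContinuous.ae_le hk)
  filter_upwards [h1, h2] with ω hω hω'
  rw [totalNewSimulations_congr_sets hω']
  simp only [hω]

end Setting

/-- The integrals of a bounded function of two variables that rarely differ are close. -/
theorem abs_integral_map_sub_le {Ω : Type*} [MeasurableSpace Ω] {Q : Measure Ω}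
    [IsProbabilityMeasure Q] {S T : Ω → ℕ} (hS : Measurable S) (hT : Measurable T)
    (f : BoundedContinuousFunction ℕ ℝ) :
    |∫ n, f n ∂Q.map S - ∫ n, f n ∂Q.map T| ≤ 2 * ‖f‖ * Q.real {ω | S ω ≠ T ω} := by
  have hset : MeasurableSet {ω | S ω ≠ T ω} := (measurableSet_eq_fun hS hT).compl
  have hint : ∀ {R : Ω → ℕ}, Measurable R → Integrable (fun ω => f (R ω)) Q := fun {R} hR =>
    Integrable.of_bound ((Measurable.of_discrete (f := f)).comp hR).aestronglyMeasurable ‖f‖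
      (Eventually.of_forall fun ω => f.norm_coe_le_norm _)
  rw [integral_map hS.aemeasurable Measurable.of_discrete.aestronglyMeasurable,
    integral_map hT.aemeasurable Measurable.of_discrete.aestronglyMeasurable,
    ← integral_sub (hint hS) (hint hT), ← Real.norm_eq_abs]
  have hbound := norm_integral_le_of_norm_le (μ := Q) (f := fun ω => f (S ω) - f (T ω))
    (g := {ω | S ω ≠ T ω}.indicator fun _ => 2 * ‖f‖)
    ((integrable_const _).indicator hset) (Eventually.of_forall fun ω => by
      by_cases h : S ω = T ω
      · simp [h]
      · rw [Set.indicator_of_mem (show ω ∈ {ω | S ω ≠ T ω} from h), two_mul]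
        exact (norm_sub_le _ _).trans
          (add_le_add (f.norm_coe_le_norm _) (f.norm_coe_le_norm _)))
  refine hbound.trans_eq ?_
  rw [integral_indicator hset, setIntegral_const, smul_eq_mul, mul_comm]

theorem poissonArray_real_sum_min_ne_sum_le {m N : ℕ} (r : Fin m → ℝ≥0) {ε : ℝ}
    (hr : ∀ ℓ, (r ℓ : ℝ) ≤ ε) :
    (poissonArray N r).real {z | ∑ ℓ, ∑ i, min (z ℓ i) 1 ≠ ∑ ℓ, ∑ i, z ℓ i} ≤
      N * (ε * ∑ ℓ, (r ℓ : ℝ)) := by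
  have h1 : ∑ ℓ, (N : ℝ≥0∞) * ENNReal.ofReal ((r ℓ : ℝ) ^ 2) =
      ENNReal.ofReal (∑ ℓ, N * (r ℓ : ℝ) ^ 2) := by
    rw [ENNReal.ofReal_sum_of_nonneg fun ℓ _ => by positivity]
    refine Finset.sum_congr rfl fun ℓ _ => ?_
    rw [ENNReal.ofReal_mul (by positivity), ENNReal.ofReal_natCast]
  have h2 := poissonArray_sum_min_ne_sum_le (N := N) r
  rw [h1] at h2
  refine (ENNReal.toReal_le_of_le_ofReal (by positivity) h2).trans ?_
  rw [← Finset.mul_sum]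
  refine mul_le_mul_of_nonneg_left ?_ N.cast_nonneg
  rw [Finset.mul_sum]
  refine Finset.sum_le_sum fun ℓ _ => ?_
  rw [sq]
  exact mul_le_mul_of_nonneg_right (hr ℓ) (r ℓ).coe_nonneg

end SampleReuse

theorem theorem3 (d N : ℕ) (hN : 1 ≤ N) (Vmax Vmin : ℝ) (hVmin : 0 < Vmin) (hV : Vmin < Vmax)
    -- a Poisson random variable `Z` with mean `N * log (Vmax / Vmin)`
    {Ω' : Type*} [MeasurableSpace Ω'] (P' : Measure Ω') [IsProbabilityMeasure P'] (Z : Ω' → ℕ)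
    (hZ : HasLaw Z (poissonMeasure (Real.toNNReal (N * Real.log (Vmax / Vmin)))) P') :
    -- comparison of the cumulative distribution functions
    (∀ {Ω : Type*} [MeasurableSpace Ω] (P : Measure Ω) [IsProbabilityMeasure P] (m : ℕ)
        (B : Fin (m + 1) → Set (EuclideanSpace ℝ (Fin d)))
        (X : Fin (m + 1) → Fin N → Ω → EuclideanSpace ℝ (Fin d)),
        SampleReuse.Setting P Vmax Vmin B X →
        P {ω | SampleReuse.totalNewSimulations B (fun ℓ i => X ℓ i ω) = 0} = P' {ω | Z ω = 0} ∧
        ∀ k : ℕ, 1 ≤ k →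
          P' {ω | Z ω ≤ k} <
            P {ω | SampleReuse.totalNewSimulations B (fun ℓ i => X ℓ i ω) ≤ k}) ∧
    -- convergence in distribution as the maximum volume gap tends to zero
    (∀ {ι : Type*} (l : Filter ι) {Ω : ι → Type*} [∀ j, MeasurableSpace (Ω j)]
        (P : ∀ j, Measure (Ω j)) [∀ j, IsProbabilityMeasure (P j)] (m : ι → ℕ)
        (B : ∀ j, Fin (m j + 1) → Set (EuclideanSpace ℝ (Fin d)))
        (X : ∀ j, Fin (m j + 1) → Fin N → Ω j → EuclideanSpace ℝ (Fin d)),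
        (∀ j, SampleReuse.Setting (P j) Vmax Vmin (B j) (X j)) →
        Tendsto (fun j => SampleReuse.maxVolumeGap (B j)) l (𝓝 0) →
        TendstoInDistribution
          (fun j ω => SampleReuse.totalNewSimulations (B j) (fun ℓ i => X j ℓ i ω)) l Z P P') := by
  refine ⟨?_, ?_⟩
  · intro Ω _ P _ m B X h
    have hlaw := h.hasLaw_totalNewSimulations hVmin
    have hT : Measurable fun z : Fin m → Fin N → ℕ => ∑ ℓ, ∑ i, min (z ℓ i) 1 := by fun_prop
    have hS : Measurable fun z : Fin m → Fin N → ℕ => ∑ ℓ, ∑ i, z ℓ i := by fun_prop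
    have hZ' : HasLaw Z ((SampleReuse.poissonArray N (SampleReuse.rate B)).map
        fun z => ∑ ℓ, ∑ i, z ℓ i) P' := by
      rwa [SampleReuse.map_sum_poissonArray, h.sum_mul_rate hVmin hV]
    have hset : ∀ s : Set ℕ, MeasurableSet s := fun s => MeasurableSet.of_discrete
    refine ⟨?_, fun k hk => ?_⟩
    · rw [hlaw.measure_eq (p := fun n => n = 0) (hset _),
        hZ'.measure_eq (p := fun n => n = 0) (hset _), Measure.map_apply hT (hset _),
        Measure.map_apply hS (hset _)]
      congr 1
      ext z
      exact SampleReuse.sum_min_eq_zero_iff z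
    · rw [hlaw.measure_eq (p := fun n => n ≤ k) (hset _),
        hZ'.measure_eq (p := fun n => n ≤ k) (hset _), Measure.map_apply hT (hset _),
        Measure.map_apply hS (hset _)]
      obtain ⟨ℓ₀, hℓ₀⟩ := h.exists_rate_pos hVmin hV
      exact SampleReuse.poissonArray_sum_le_lt _ hN hℓ₀ hk
  · intro ι l Ω _ P _ m B X h hgap
    have hlaw := fun j => (h j).hasLaw_totalNewSimulations hVmin
    refine ⟨fun j => (hlaw j).aemeasurable, hZ.aemeasurable, ?_⟩
    refine ProbabilityMeasure.tendsto_iff_forall_integral_tendsto.2 fun f => ?_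
    -- The factor `2 * ‖f‖` bounds the change in `f` where the sums differ; the rest bounds the
    -- probability of that event, through `∑ r ℓ ^ 2 ≤ max r * ∑ r ℓ`.
    have hlim : Tendsto (fun j => 2 * ‖f‖ * (N * (SampleReuse.maxVolumeGap (B j) / Vmin *
        Real.log (Vmax / Vmin)))) l (𝓝 0) := by
      have := ((((hgap.div_const Vmin).mul_const (Real.log (Vmax / Vmin))).const_mul
        (N : ℝ)).const_mul (2 * ‖f‖))
      simpa using this
    rw [tendsto_iff_norm_sub_tendsto_zero]
    refine squeeze_zero (fun _ => norm_nonneg _) (fun j => ?_) hlim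
    have hT : Measurable fun z : Fin (m j) → Fin N → ℕ => ∑ ℓ, ∑ i, min (z ℓ i) 1 := by fun_prop
    have hS : Measurable fun z : Fin (m j) → Fin N → ℕ => ∑ ℓ, ∑ i, z ℓ i := by fun_prop
    have hb := SampleReuse.abs_integral_map_sub_le
      (Q := SampleReuse.poissonArray N (SampleReuse.rate (B j))) hT hS f
    rw [SampleReuse.map_sum_poissonArray, (h j).sum_mul_rate hVmin hV, ← hZ.map_eq,
      ← (hlaw j).map_eq] at hb
    have hp := SampleReuse.poissonArray_real_sum_min_ne_sum_le (N := N)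
      (SampleReuse.rate (B j)) ((h j).rate_le hVmin)
    rw [(h j).sum_rate hVmin hV] at hp
    exact hb.trans (mul_le_mul_of_nonneg_left hp (by positivity))
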